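/- **Setting.** A coordinator and $k\ge 1$ players track a threshold $N\ge 1$. Items arrive one at a time, each at one player; the coordinator must raise an alarm exactly when the $N$-th item arrives. The communication cost is the number of messages sent or received by the coordinator. Let $\mu_1,\dots,\mu_k\ge 0$ with $\sum_i\mu_i=1$ be known, and let $0<\delta<1$. **Algorithm StcSlk-KwnDst** (a 1-Notification-to-End algorithm). It runs in rounds; at the start of each round all counters $n_i$ (items received by player $i$ in the round) are set to $0$. Let $N$ denote the current remaining threshold and $\beta=2(\sqrt2+\tfrac23)^2$. 1. If $N\le 4k$, run the straightforward algorithm: after one instructing message to each player, each item triggers one message, and the alarm is raised at the $N$-th one. 2. Otherwise, if $N\le \beta k\ln\frac k\delta$, run the CMY algorithm until termination. CMY works in rounds: if $N<4k$, run the straightforward algorithm; otherwise send the slack $s=\lfloor N/(2k)\rfloor$ to every player; a player notifies the coordinator each time its counter has grown by $s$; at the $k$-th notification the coordinator requests and receives all counters, replaces $N$ by $N-\sum_i n_i$, and starts a new CMY round. 3. Otherwise, with $t=N-(\sqrt2+\tfrac23)\sqrt{kN\ln\frac k\delta}$, send to player $i$ the slack $s_i=\mu_i t+\sqrt{2t\mu_i(1-\mu_i)\ln\frac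 k\delta}+\tfrac23\ln\frac k\delta$. Player $i$ notifies the coordinator as soon as $n_i$ reaches $s_i$ (i.e. $n_i\ge s_i$). At the first notification the coordinator requests and receives all counters and replaces $N$ by $N-\sum_i n_i$; if the result is $0$ it raises the alarm, otherwise a new round starts at step 1. Every round of every kind (static-slack, CMY, straightforward) is counted as a round. Logarithms inside $\log\log$ are read as $\max\{1,\log(\cdot)\}$, i.e. $\log\log x:=\max\{1,\ln\max\{1,\ln x\}\}$, so that the bounds are meaningful for all parameters. **Theorem.** There is an absolute constant $C>0$ such that for all $k,N\ge1$, $\delta\in(0,1)$ and $\mu$ as above, the following holds. On every input stream the algorithm raises the alarm exactly at the arrival of the $N$-th item. If, moreover, the items go independently to the players, each to player $i$ with probability $\mu_i$, then with probability at least $1-\delta\cdot C\log\log N$ the algorithm both * runs at most $C\left(\log\log\frac{N}{k\ln(k/\delta)}+\log\log\frac k\delta\right)$ rounds, and * has total communication cost at most $C\left(k\log\log\frac{N}{k\ln(k/\delta)}+k\log\log\frac k\delta\right)$. -/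

import Mathlib

open MeasureTheory ProbabilityTheory

namespace DistTracking

/-- The kind of round that is being executed; `alarm` means that the coordinator has raised
the alarm and the algorithm has terminated. -/
inductive Phase where
  /-- every player sends a message for every item -/
  | straightforward
  /-- a round of the CMY algorithm (which, once entered, is run until it terminates) -/
  | cmy
  /-- a round with the static, distribution-dependent slacks -/
  | staticSlack
  | alarm
  deriving DecidableEq

/-- Global state of coordinator and players (plus the two quantities that are measured). -/
structure State (k : ℕ) where
  phase : Phase
  /-- the threshold `N` of the current round -/
  threshold : ℕ
  /-- the counters `n_i`, reset to `0` at the start of each round -/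
  counter : Fin k → ℕ
  /-- number of notifications received by the coordinator in the current round -/
  notifications : ℕ
  /-- number of rounds (of all three kinds) started so far -/
  rounds : ℕ
  /-- number of messages sent or received by the coordinator so far -/
  messages : ℕ

noncomputable section

/-- `√2 + 2/3`. -/
def slackConst : ℝ := Real.sqrt 2 + 2 / 3

/-- `β = 2 (√2 + 2/3)²`. -/
def beta : ℝ := 2 * slackConst ^ 2

/-- `t = N - (√2 + 2/3) √(k N ln(k/δ))`. -/
def target (k : ℕ) (δ : ℝ) (N : ℕ) : ℝ :=
  N - slackConst * Real.sqrt (k * N * Real.log (k / δ))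

/-- `s_i = μ_i t + √(2 t μ_i (1 - μ_i) ln(k/δ)) + (2/3) ln(k/δ)`. -/
def slack {k : ℕ} (μ : Fin k → ℝ) (δ : ℝ) (N : ℕ) (i : Fin k) : ℝ :=
  μ i * target k δ N
    + Real.sqrt (2 * target k δ N * μ i * (1 - μ i) * Real.log (k / δ))
    + 2 / 3 * Real.log (k / δ)

/-- The slack `⌊N / (2k)⌋` of the CMY algorithm. -/
def cmySlack (k N : ℕ) : ℕ := N / (2 * k)

/-- Which kind of round is run on threshold `N` when the preceding kind was `prev`.
At the very beginning, `prev` is `staticSlack`. -/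
def nextPhase (k : ℕ) (δ : ℝ) (prev : Phase) (N : ℕ) : Phase :=
  open Classical in
  if N = 0 then .alarm
  else if prev = .cmy then
    if N < 4 * k then .straightforward else .cmy
  else
    if N ≤ 4 * k then .straightforward
    else if (N : ℝ) ≤ beta * k * Real.log (k / δ) then .cmy
    else .staticSlack

/-- Whether player `i`, whose counter has just been increased to `n`, notifies the coordinator.
In a static-slack round this is when `n` reaches the (real) slack `s_i`. -/
def notifies {k : ℕ} (μ : Fin k → ℝ) (δ : ℝ) (N : ℕ) (i : Fin k) (n : ℕ) : Phase → Prop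
  | .straightforward => True
  | .cmy => cmySlack k N ∣ n
  | .staticSlack => slack μ δ N i ≤ n
  | .alarm => False

/-- The number `ℓ` of notifications that ends a round with threshold `N`. -/
def quota (k N : ℕ) : Phase → ℕ
  | .straightforward => N
  | .cmy => k
  | .staticSlack => 1
  | .alarm => 0

/-- Messages used for collecting the counters at the end of a round: one request to and one
reply from each player; nothing has to be collected by the straightforward algorithm. -/
def collectCost (k : ℕ) : Phase → ℕ
  | .straightforward => 0
  | .cmy => 2 * k
  | .staticSlack => 2 * k
  | .alarm => 0

/-- Start a round on threshold `N` by one message to each player (the slack, or the instruction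
to run the straightforward algorithm); if `N = 0`, raise the alarm instead. -/
def startRound (k : ℕ) (δ : ℝ) (prev : Phase) (N rounds messages : ℕ) : State k where
  phase := nextPhase k δ prev N
  threshold := N
  counter := fun _ => 0
  notifications := 0
  rounds := if N = 0 then rounds else rounds + 1
  messages := if N = 0 then messages else messages + k

/-- The transition caused by the arrival of one item at player `i`. -/
def step {k : ℕ} (μ : Fin k → ℝ) (δ : ℝ) (s : State k) (i : Fin k) : State k :=
  open Classical in
  if s.phase = .alarm then s
  else
    let c : Fin k → ℕ := Function.update s.counter i (s.counter i + 1)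
    if notifies μ δ s.threshold i (c i) s.phase then
      if s.notifications + 1 = quota k s.threshold s.phase then
        startRound k δ s.phase (s.threshold - ∑ j, c j) s.rounds
          (s.messages + 1 + collectCost k s.phase)
      else
        { s with
          counter := c
          notifications := s.notifications + 1
          messages := s.messages + 1 }
    else { s with counter := c }

/-- The state of StcSlk-KwnDst with threshold `N`, distribution `μ` and parameter `δ` after the
first `n` items `x 0, …, x (n - 1)` have arrived, where `x j` is the player receiving item `j`. -/
def run {k : ℕ} (μ : Fin k → ℝ) (δ : ℝ) (N : ℕ) (x : ℕ → Fin k) : ℕ → State k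
  | 0 => startRound k δ .staticSlack N 0 0
  | n + 1 => step μ δ (run μ δ N x n) (x n)

/-- `log log x` with each logarithm read as `max 1 (log ·)`, the usual convention under which
asymptotic bounds make sense for all values of the parameters. -/
def logLog (x : ℝ) : ℝ := max 1 (Real.log (max 1 (Real.log x)))

end

end DistTracking

namespace DistTracking

/-! Write `L = ln(k/δ)` and `c = √2 + 2/3`. Correctness is deterministic: in every kind of round,
fewer items than the current threshold have arrived while the round is still open
(`RoundInv.sum_lt`). Since round start plus threshold is always `N`, the alarm can be neither early
nor late (`run_invariant`). Each round costs at most `5k` messages, so it remains to bound the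
number of rounds.

Call a static-slack round good if no player reaches its slack within the first `⌊t⌋` items. A good
round leaves a threshold below `N - t = c√(kNL)`, so the ratio of threshold to `c²kL` falls at least
to its square root, and its iterated binary logarithm drops by one. Once static rounds stop, CMY
multiplies the threshold by at most `3/4` per round, starting from at most `βkL` and stopping near
`4k`. The function `potential` encodes both decays, and `rounds_add_potential_le` shows that rounds
plus potential never exceeds its initial bound, provided the static rounds among the first `R`
rounds are good.

For a fixed starting item, Bernstein's inequality (`count_tail`) and a union bound over players make
a round bad with probability at most `δ`. Starting items are random, but whether a round starts at
item `a` depends only on earlier items and its goodness only on later ones, so the two events are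
independent. Summing over `a`, at most `R` static starts are counted, hence some relevant round is
bad with probability at most `δR` (`exists_bad_le`). -/

/-! ### Size of the slacks. -/

lemma slackConst_pos : 0 < slackConst := by
  unfold slackConst; positivity

lemma beta_pos : 0 < beta := by
  have := slackConst_pos
  unfold beta; positivity

lemma four_lt_slackConst_sq : 4 < slackConst ^ 2 := by
  have h2 : Real.sqrt 2 ^ 2 = 2 := Real.sq_sqrt (by norm_num)
  have h1 : 1.4 ≤ Real.sqrt 2 := Real.le_sqrt_of_sq_le (by norm_num)
  unfold slackConst; nlinarith

lemma beta_le_ten : beta ≤ 10 := by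
  have h2 : Real.sqrt 2 ^ 2 = 2 := Real.sq_sqrt (by norm_num)
  have h1 : Real.sqrt 2 ≤ 1.5 := Real.sqrt_le_iff.mpr (by norm_num)
  unfold beta slackConst; nlinarith

lemma log_div_pos {k : ℕ} {δ : ℝ} (hk : 0 < k) (h0 : 0 < δ) (h1 : δ < 1) :
    0 < Real.log (k / δ) := by
  apply Real.log_pos
  rw [lt_div_iff₀ h0]
  have : (1 : ℝ) ≤ k := by exact_mod_cast hk
  linarith

/-- In the range of the static-slack rounds the target is positive. -/
lemma target_pos {k N : ℕ} {δ : ℝ} (hL : 0 < Real.log (k / δ))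
    (hN : beta * k * Real.log (k / δ) < N) : 0 < target k δ N := by
  unfold target
  have hc := slackConst_pos
  set L := Real.log (k / δ)
  have hkL : 0 ≤ (k : ℝ) * L := by positivity
  have hNpos : (0 : ℝ) < N := lt_of_le_of_lt (by have := beta_pos; positivity) hN
  have h : Real.sqrt (k * N * L) < N / slackConst := by
    rw [Real.sqrt_lt' (by positivity), div_pow, lt_div_iff₀ (by positivity)]
    unfold beta at hN
    nlinarith [mul_nonneg (sq_nonneg slackConst) hkL]
  rw [lt_div_iff₀ hc] at h
  linarith

lemma target_le (k N : ℕ) (δ : ℝ) : target k δ N ≤ N := by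
  have := slackConst_pos
  unfold target
  have : 0 ≤ slackConst * Real.sqrt (k * N * Real.log (k / δ)) := by positivity
  linarith

/-- The slacks of a static-slack round sum up to at most the threshold. -/
lemma sum_slack_le {k N : ℕ} {δ : ℝ} {μ : Fin k → ℝ} (hL : 0 < Real.log (k / δ))
    (hμ : ∀ i, 0 ≤ μ i) (hsum : ∑ i, μ i = 1)
    (hN : beta * k * Real.log (k / δ) < N) : ∑ i, slack μ δ N i ≤ N := by
  have ht := target_pos hL hN
  have htN := target_le k N δ
  have hμ1 : ∀ i, μ i ≤ 1 := fun i => hsum ▸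
    Finset.single_le_sum (f := μ) (fun j _ => hμ j) (Finset.mem_univ i)
  have hdef : target k δ N = N - slackConst * Real.sqrt (k * N * Real.log (k / δ)) := rfl
  unfold slack
  set t := target k δ N
  set L := Real.log (k / δ)
  have hk0 : (0 : ℝ) ≤ k := by positivity
  rw [Finset.sum_add_distrib, Finset.sum_add_distrib, ← Finset.sum_mul, hsum]
  have hvar : ∀ i, 0 ≤ 2 * t * μ i * (1 - μ i) * L := fun i => by
    have := hμ i
    have : 0 ≤ 1 - μ i := by linarith [hμ1 i]
    positivity
  -- Cauchy–Schwarz yields the `√2` of `slackConst`. The `2/3` comes from the additive terms,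
  -- through `kL ≤ √(kNL)` below. Together they use up exactly `N - t`.
  have hCS : ∑ i, Real.sqrt (2 * t * μ i * (1 - μ i) * L) ≤ Real.sqrt 2 * Real.sqrt (k * N * L) := by
    rw [← Real.sqrt_mul (by norm_num)]
    apply Real.le_sqrt_of_sq_le
    have h1 := sq_sum_le_card_mul_sum_sq (s := (Finset.univ : Finset (Fin k)))
      (f := fun i => Real.sqrt (2 * t * μ i * (1 - μ i) * L))
    simp only [Finset.card_univ, Fintype.card_fin] at h1
    refine h1.trans ?_
    have h2 : ∑ i, Real.sqrt (2 * t * μ i * (1 - μ i) * L) ^ 2 ≤ ∑ i, 2 * t * L * μ i := by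
      apply Finset.sum_le_sum
      intro i _
      rw [Real.sq_sqrt (hvar i)]
      have : 0 ≤ 2 * t * L * μ i * μ i := by
        have := hμ i
        positivity
      linarith
    rw [← Finset.mul_sum, hsum, mul_one] at h2
    have h3 : 2 * t * L ≤ 2 * N * L := by gcongr
    nlinarith [mul_le_mul_of_nonneg_left (h2.trans h3) hk0]
  have hkL : k * L ≤ Real.sqrt (k * N * L) := by
    apply Real.le_sqrt_of_sq_le
    have h8 : (1 : ℝ) ≤ beta := by
      have := four_lt_slackConst_sq
      unfold beta; linarith
    have : k * L ≤ N := by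
      have : 0 ≤ (k : ℝ) * L := by positivity
      nlinarith
    have h0 : 0 ≤ (k : ℝ) * L := by positivity
    nlinarith
  have hlast : ∑ _i : Fin k, 2 / 3 * L = 2 / 3 * (k * L) := by
    simp; ring
  rw [hlast]
  have : slackConst * Real.sqrt (k * N * L)
      = Real.sqrt 2 * Real.sqrt (k * N * L) + 2 / 3 * Real.sqrt (k * N * L) := by
    unfold slackConst; ring
  linarith

lemma slack_pos {k N : ℕ} {δ : ℝ} {μ : Fin k → ℝ} (hL : 0 < Real.log (k / δ))
    (hμ : ∀ i, 0 ≤ μ i) (hN : beta * k * Real.log (k / δ) < N) (i : Fin k) :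
    0 < slack μ δ N i := by
  have ht := target_pos hL hN
  have := hμ i
  unfold slack
  positivity

lemma cmySlack_pos {k T : ℕ} (hk : 0 < k) (hT : 4 * k ≤ T) : 0 < cmySlack k T := by
  unfold cmySlack
  exact Nat.div_pos (by omega) (by omega)

/-- Up to `k` notifications of a CMY round account for fewer than `T` items. -/
lemma sum_lt_of_sum_div_le {k T : ℕ} (hk : 0 < k) (hT : 4 * k ≤ T) {c : Fin k → ℕ}
    (hc : ∑ i, c i / cmySlack k T ≤ k) : ∑ i, c i < T := by
  have hs := cmySlack_pos hk hT
  have hsT : 2 * k * cmySlack k T ≤ T := Nat.mul_div_le _ _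
  set s := cmySlack k T
  -- Reported items number at most `ks`, and each player hides at most `s - 1` more; the spare `1`
  -- per player makes the final inequality strict.
  have h1 : ∑ i, (c i + 1) ≤ ∑ i, (s * (c i / s) + s) := by
    apply Finset.sum_le_sum
    intro i _
    have := Nat.div_add_mod (c i) s
    have := Nat.mod_lt (c i) hs
    omega
  rw [Finset.sum_add_distrib, Finset.sum_add_distrib, ← Finset.mul_sum] at h1
  simp only [Finset.sum_const, Finset.card_univ, Fintype.card_fin, smul_eq_mul] at h1
  have h2 := Nat.mul_le_mul_left s hc
  have : 2 * k * s = s * k + k * s := by ring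
  omega

lemma mul_sum_div_le {k : ℕ} (s : ℕ) (c : Fin k → ℕ) : s * ∑ i, c i / s ≤ ∑ i, c i := by
  rw [Finset.mul_sum]
  exact Finset.sum_le_sum fun i _ => Nat.mul_div_le _ _

/-! ### Invariants of the run, correctness and message count. -/

/-- The counters after an item has arrived at player `i`. -/
def bump {k : ℕ} (c : Fin k → ℕ) (i : Fin k) : Fin k → ℕ := Function.update c i (c i + 1)

@[simp] lemma bump_self {k : ℕ} (c : Fin k → ℕ) (i : Fin k) : bump c i i = c i + 1 := by
  simp [bump]

lemma bump_apply {k : ℕ} (c : Fin k → ℕ) (i j : Fin k) :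
    bump c i j = c j + if i = j then 1 else 0 := by
  unfold bump
  by_cases h : i = j
  · subst h; simp
  · simp [Function.update_of_ne (Ne.symm h), h]

lemma sum_bump {k : ℕ} (c : Fin k → ℕ) (i : Fin k) : ∑ j, bump c i j = ∑ j, c j + 1 := by
  simp [bump_apply, Finset.sum_add_distrib]

lemma sum_bump_div {k : ℕ} (c : Fin k → ℕ) (i : Fin k) (s : ℕ) :
    ∑ j, bump c i j / s = ∑ j, c j / s + if s ∣ c i + 1 then 1 else 0 := by
  have : ∀ j, bump c i j / s = c j / s + if i = j then (if s ∣ c i + 1 then 1 else 0) else 0 := by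
    intro j
    rw [bump_apply]
    by_cases h : i = j
    · subst h; simp [Nat.succ_div]
    · simp [h]
  simp [this, Finset.sum_add_distrib]

/-- What is known about a state that is reached while a round of the given kind is running. -/
def RoundInv {k : ℕ} (μ : Fin k → ℝ) (δ : ℝ) (s : State k) : Phase → Prop
  | .straightforward =>
      s.threshold ≤ 4 * k ∧ s.notifications = ∑ i, s.counter i ∧ ∑ i, s.counter i < s.threshold
  | .cmy =>
      4 * k ≤ s.threshold ∧ s.notifications = ∑ i, s.counter i / cmySlack k s.threshold ∧
        s.notifications < k
  | .staticSlack =>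
      beta * k * Real.log (k / δ) < s.threshold ∧ s.notifications = 0 ∧
        ∀ i, (s.counter i : ℝ) < slack μ δ s.threshold i
  | .alarm => True

/-- An open round cannot overshoot; this makes the truncated subtraction in `finish` exact. -/
lemma RoundInv.sum_lt {k : ℕ} {μ : Fin k → ℝ} {δ : ℝ} {s : State k} (hk : 0 < k)
    (hL : 0 < Real.log (k / δ)) (hμ : ∀ i, 0 ≤ μ i) (hsum : ∑ i, μ i = 1)
    (ha : s.phase ≠ .alarm) (h : RoundInv μ δ s s.phase) :
    ∑ i, s.counter i < s.threshold := by
  cases hp : s.phase <;> rw [hp] at h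
  · exact h.2.2
  · exact sum_lt_of_sum_div_le hk h.1 (h.2.1 ▸ h.2.2.le)
  · have hlt : ∑ i, (s.counter i : ℝ) < ∑ i, slack μ δ s.threshold i := by
      have : Nonempty (Fin k) := ⟨⟨0, hk⟩⟩
      exact Finset.sum_lt_sum_of_nonempty Finset.univ_nonempty fun i _ => h.2.2 i
    have := hlt.trans_le (sum_slack_le hL hμ hsum h.1)
    exact_mod_cast this
  · exact absurd hp ha

lemma nextPhase_eq_alarm_iff {k N : ℕ} {δ : ℝ} {prev : Phase} :
    nextPhase k δ prev N = .alarm ↔ N = 0 := by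
  unfold nextPhase
  split_ifs <;> simp_all

lemma roundInv_startRound {k N : ℕ} {μ : Fin k → ℝ} {δ : ℝ} (prev : Phase) (r m : ℕ) (hk : 0 < k)
    (hL : 0 < Real.log (k / δ)) (hμ : ∀ i, 0 ≤ μ i) (hN : 0 < N) :
    RoundInv μ δ (startRound k δ prev N r m) (nextPhase k δ prev N) := by
  unfold nextPhase
  split_ifs with h1 h2 h3 h4 h5
  · omega
  · simp [RoundInv, startRound]; omega
  · simp [RoundInv, startRound]; omega
  · simp [RoundInv, startRound]; omega
  · simp [RoundInv, startRound]; omega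
  · have := not_le.mp h5
    simpa [RoundInv, startRound, this] using slack_pos hL hμ this

/-- The state while the current round goes on. -/
def advance {k : ℕ} (s : State k) (i : Fin k) (d : ℕ) : State k :=
  { s with
    counter := bump s.counter i
    notifications := s.notifications + d
    messages := s.messages + d }

/-- The state after the arrival of an item has completed the current round. -/
noncomputable def finish {k : ℕ} (δ : ℝ) (s : State k) : State k :=
  startRound k δ s.phase (s.threshold - (∑ j, s.counter j + 1)) s.rounds
    (s.messages + 1 + collectCost k s.phase)

/-- Outside the alarm state an item either lets the current round go on or completes it. -/
lemma step_cases {k : ℕ} (μ : Fin k → ℝ) (δ : ℝ) (s : State k) (i : Fin k)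
    (ha : s.phase ≠ .alarm) :
    (∃ d ≤ 1, step μ δ s i = advance s i d ∧
      (notifies μ δ s.threshold i (s.counter i + 1) s.phase →
        d = 1 ∧ s.notifications + 1 ≠ quota k s.threshold s.phase) ∧
      (¬ notifies μ δ s.threshold i (s.counter i + 1) s.phase → d = 0)) ∨
    (step μ δ s i = finish δ s ∧ notifies μ δ s.threshold i (s.counter i + 1) s.phase ∧
      s.notifications + 1 = quota k s.threshold s.phase) := by
  have hsum := sum_bump s.counter i
  by_cases hn : notifies μ δ s.threshold i (s.counter i + 1) s.phase
  · by_cases hq : s.notifications + 1 = quota k s.threshold s.phase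
    · right
      refine ⟨?_, hn, hq⟩
      unfold bump at hsum
      simp only [step, ha, if_false, Function.update_self, hn, if_true, hq, finish, hsum]
    · left
      refine ⟨1, le_rfl, ?_, fun _ => ⟨rfl, hq⟩, fun h => absurd hn h⟩
      simp only [step, ha, if_false, Function.update_self, hn, if_true, hq, advance, bump]
  · left
    refine ⟨0, by omega, ?_, fun h => absurd h hn, fun _ => rfl⟩
    simp only [step, ha, if_false, Function.update_self, hn, advance, bump, add_zero]

lemma step_alarm {k : ℕ} (μ : Fin k → ℝ) (δ : ℝ) (s : State k) (i : Fin k)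
    (ha : s.phase = .alarm) : step μ δ s i = s := by
  simp [step, ha]

lemma RoundInv.advance {k : ℕ} {μ : Fin k → ℝ} {δ : ℝ} {s : State k} {i : Fin k} {d : ℕ}
    (h : RoundInv μ δ s s.phase)
    (h1 : notifies μ δ s.threshold i (s.counter i + 1) s.phase →
      d = 1 ∧ s.notifications + 1 ≠ quota k s.threshold s.phase)
    (h2 : ¬ notifies μ δ s.threshold i (s.counter i + 1) s.phase → d = 0) :
    RoundInv μ δ (advance s i d) s.phase := by
  cases hp : s.phase <;> rw [hp] at h h1 h2
  · obtain ⟨hd, hq⟩ := h1 trivial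
    simp only [quota] at hq
    simp only [RoundInv, DistTracking.advance, sum_bump] at h ⊢
    omega
  · simp only [RoundInv, DistTracking.advance, sum_bump_div] at h ⊢
    by_cases hn : cmySlack k s.threshold ∣ s.counter i + 1
    · obtain ⟨hd, hq⟩ := h1 hn
      simp only [quota] at hq
      rw [if_pos hn]
      omega
    · have hd := h2 hn
      rw [if_neg hn]
      omega
  · simp only [RoundInv, DistTracking.advance] at h ⊢
    by_cases hn : slack μ δ s.threshold i ≤ ((s.counter i + 1 : ℕ) : ℝ)
    · obtain ⟨hd, hq⟩ := h1 hn
      simp only [quota] at hq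
      omega
    · have hd := h2 hn
      refine ⟨h.1, by omega, fun j => ?_⟩
      rw [bump_apply]
      by_cases hij : i = j
      · subst hij; simpa using hn
      · simpa [hij] using h.2.2 j
  · trivial

/-- When a CMY round is completed, at least `k` times the slack has arrived. -/
lemma RoundInv.cmy_finish {k : ℕ} {μ : Fin k → ℝ} {δ : ℝ} {s : State k} {i : Fin k}
    (h : RoundInv μ δ s .cmy) (hn : notifies μ δ s.threshold i (s.counter i + 1) .cmy)
    (hq : s.notifications + 1 = quota k s.threshold .cmy) :
    cmySlack k s.threshold * k ≤ ∑ j, s.counter j + 1 := by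
  have h1 := mul_sum_div_le (cmySlack k s.threshold) (bump s.counter i)
  change cmySlack k s.threshold ∣ s.counter i + 1 at hn
  rw [sum_bump_div, sum_bump, if_pos hn, ← h.2.1, hq] at h1
  exact h1

/-- The relation of a state of the run, reached after `n` items, to the start `a` of the
current round. -/
structure RunInv {k : ℕ} (μ : Fin k → ℝ) (δ : ℝ) (N : ℕ) (x : ℕ → Fin k) (n : ℕ) (s : State k)
    (a : ℕ) : Prop where
  start_add : a + ∑ i, s.counter i = n
  start_add_threshold : a + s.threshold = N
  counter_eq : ∀ i, s.counter i = ((Finset.Ico a n).filter fun j => x j = i).card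
  phase_start : (run μ δ N x a).phase = s.phase
  rounds_start : (run μ δ N x a).rounds = s.rounds
  counter_start : (run μ δ N x a).counter = fun _ => 0
  roundInv : RoundInv μ δ s s.phase
  messages_le : s.messages + 4 * k ≤ 5 * k * s.rounds + s.notifications

lemma runInv_startRound {k N : ℕ} {μ : Fin k → ℝ} {δ : ℝ} {x : ℕ → Fin k} (prev : Phase)
    {n T r m : ℕ} (hk : 0 < k) (hL : 0 < Real.log (k / δ)) (hμ : ∀ i, 0 ≤ μ i)
    (hrun : run μ δ N x n = startRound k δ prev T r m) (hT : 0 < T) (hn : n + T = N)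
    (hm : m ≤ 5 * k * r) : RunInv μ δ N x n (run μ δ N x n) n where
  start_add := by simp [hrun, startRound]
  start_add_threshold := by simp [hrun, startRound, hn]
  counter_eq := by simp [hrun, startRound]
  phase_start := rfl
  rounds_start := rfl
  counter_start := by simp [hrun, startRound]
  roundInv := by
    rw [hrun]; exact roundInv_startRound prev r m hk hL hμ hT
  messages_le := by
    simp [hrun, startRound, hT.ne']
    nlinarith

lemma RunInv.lt {k N n a : ℕ} {μ : Fin k → ℝ} {δ : ℝ} {x : ℕ → Fin k} {s : State k} (hk : 0 < k)
    (hL : 0 < Real.log (k / δ)) (hμ : ∀ i, 0 ≤ μ i) (hsum : ∑ i, μ i = 1)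
    (ha : s.phase ≠ .alarm) (h : RunInv μ δ N x n s a) : n < N := by
  have := h.roundInv.sum_lt hk hL hμ hsum ha
  have := h.start_add
  have := h.start_add_threshold
  omega

lemma RunInv.advance {k N n a d : ℕ} {μ : Fin k → ℝ} {δ : ℝ} {x : ℕ → Fin k} {s : State k}
    (h : RunInv μ δ N x n s a)
    (h1 : notifies μ δ s.threshold (x n) (s.counter (x n) + 1) s.phase →
      d = 1 ∧ s.notifications + 1 ≠ quota k s.threshold s.phase)
    (h2 : ¬ notifies μ δ s.threshold (x n) (s.counter (x n) + 1) s.phase → d = 0) :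
    RunInv μ δ N x (n + 1) (advance s (x n) d) a where
  start_add := by
    have := h.start_add
    simp only [DistTracking.advance, sum_bump]; omega
  start_add_threshold := h.start_add_threshold
  counter_eq i := by
    have han : a ≤ n := by have := h.start_add; omega
    simp only [DistTracking.advance, bump_apply, h.counter_eq]
    rw [Finset.card_filter, Finset.card_filter, Finset.sum_Ico_succ_top han]
  phase_start := h.phase_start
  rounds_start := h.rounds_start
  counter_start := h.counter_start
  roundInv := h.roundInv.advance h1 h2
  messages_le := by
    have := h.messages_le
    simp only [DistTracking.advance]; omega

/-- Each round has a budget of `5k`: `k` is spent at its start, and the other `4k` covers either up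
to `4k` straightforward notifications, or `k + 2k` messages in CMY, or `1 + 2k` in a static round.
-/
lemma RunInv.messages_finish {k N n a : ℕ} {μ : Fin k → ℝ} {δ : ℝ} {x : ℕ → Fin k} {s : State k}
    (h : RunInv μ δ N x n s a) (hk : 0 < k)
    (hq : s.notifications + 1 = quota k s.threshold s.phase) :
    s.messages + 1 + collectCost k s.phase ≤ 5 * k * s.rounds := by
  have hm := h.messages_le
  have hr := h.roundInv
  cases hp : s.phase <;> rw [hp] at hq hr <;> simp only [quota, collectCost] at hq ⊢
  · have := hr.1; omega
  · omega
  · omega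
  · omega

/-- The invariant of the run: either the alarm has been raised, on time, or a round is running. -/
theorem run_invariant {k N : ℕ} {μ : Fin k → ℝ} {δ : ℝ} (hk : 0 < k) (hN : 0 < N)
    (hL : 0 < Real.log (k / δ)) (hμ : ∀ i, 0 ≤ μ i) (hsum : ∑ i, μ i = 1) (x : ℕ → Fin k)
    (n : ℕ) :
    ((run μ δ N x n).phase = .alarm ∧ N ≤ n ∧
      (run μ δ N x n).messages ≤ 5 * k * (run μ δ N x n).rounds) ∨
    ((run μ δ N x n).phase ≠ .alarm ∧ ∃ a, RunInv μ δ N x n (run μ δ N x n) a) := by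
  induction n with
  | zero =>
    right
    refine ⟨?_, 0, runInv_startRound .staticSlack hk hL hμ rfl hN (by simp) (by simp)⟩
    simp [run, startRound, nextPhase_eq_alarm_iff, hN.ne']
  | succ n ih =>
    have hstep : run μ δ N x (n + 1) = step μ δ (run μ δ N x n) (x n) := rfl
    rcases ih with ⟨ha, hn, hm⟩ | ⟨ha, a, h⟩
    · left
      rw [hstep, step_alarm _ _ _ _ ha]
      exact ⟨ha, by omega, hm⟩
    · rcases step_cases μ δ _ (x n) ha with ⟨d, _, he, h1, h2⟩ | ⟨he, hn, hq⟩
      · right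
        rw [hstep, he]
        exact ⟨ha, a, h.advance h1 h2⟩
      · have hlt := h.roundInv.sum_lt hk hL hμ hsum ha
        have h3 := h.start_add
        have h4 := h.start_add_threshold
        have h5 := h.messages_finish hk hq
        rw [finish] at he
        by_cases hT : (run μ δ N x n).threshold - (∑ j, (run μ δ N x n).counter j + 1) = 0
        · left
          rw [hstep, he, hT]
          refine ⟨by simp [startRound, nextPhase_eq_alarm_iff], by omega, ?_⟩
          simpa [startRound] using h5
        · right
          refine ⟨?_, n + 1, ?_⟩
          · rw [hstep, he]
            simpa [startRound, nextPhase_eq_alarm_iff] using hT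
          · exact runInv_startRound _ hk hL hμ (hstep.trans he) (Nat.pos_of_ne_zero hT) (by omega) h5

theorem run_phase_eq_alarm_iff {k N : ℕ} {μ : Fin k → ℝ} {δ : ℝ} (hk : 0 < k) (hN : 0 < N)
    (hL : 0 < Real.log (k / δ)) (hμ : ∀ i, 0 ≤ μ i) (hsum : ∑ i, μ i = 1) (x : ℕ → Fin k)
    (n : ℕ) : (run μ δ N x n).phase = .alarm ↔ N ≤ n := by
  rcases run_invariant hk hN hL hμ hsum x n with ⟨ha, hn, _⟩ | ⟨ha, a, h⟩
  · exact ⟨fun _ => hn, fun _ => ha⟩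
  · have := h.lt hk hL hμ hsum ha
    exact ⟨fun h => absurd h ha, fun _ => by omega⟩

/-! ### The potential and its decay. -/

/-- A bound for the number of rounds after the last static-slack round. -/
noncomputable def tailRounds (k : ℕ) (δ : ℝ) : ℝ :=
  2 + max 0 (Real.log (beta * Real.log (k / δ) / 4)) / Real.log (4 / 3)

/-- A bound for the number of rounds still to be run when a round of the given kind is started
on threshold `m`. -/
noncomputable def potential (k : ℕ) (δ : ℝ) : Phase → ℕ → ℝ
  | .straightforward, _ => 1
  | .cmy, m => 2 + Real.log (m / (4 * k)) / Real.log (4 / 3)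
  | .staticSlack, m =>
      tailRounds k δ + 1 + Real.logb 2 (Real.logb 2 (m / (slackConst ^ 2 * (k * Real.log (k / δ)))))
  | .alarm, _ => 1

lemma log_four_thirds_pos : 0 < Real.log (4 / 3) := Real.log_pos (by norm_num)

lemma two_le_tailRounds (k : ℕ) (δ : ℝ) : 2 ≤ tailRounds k δ := by
  have := log_four_thirds_pos
  unfold tailRounds
  have : 0 ≤ max 0 (Real.log (beta * Real.log (k / δ) / 4)) / Real.log (4 / 3) := by positivity
  linarith

/-- This is the purpose of `β = 2c²`: the iterated binary logarithm in `potential` stays positive as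
long as static rounds are run. -/
lemma two_lt_ratio {k T : ℕ} {δ : ℝ} (hk : 0 < k) (hL : 0 < Real.log (k / δ))
    (hT : beta * k * Real.log (k / δ) < T) :
    2 < (T : ℝ) / (slackConst ^ 2 * (k * Real.log (k / δ))) := by
  have hc := slackConst_pos
  rw [lt_div_iff₀ (by positivity)]
  unfold beta at hT
  linarith

lemma one_lt_logb_ratio {k T : ℕ} {δ : ℝ} (hk : 0 < k) (hL : 0 < Real.log (k / δ))
    (hT : beta * k * Real.log (k / δ) < T) :
    1 < Real.logb 2 ((T : ℝ) / (slackConst ^ 2 * (k * Real.log (k / δ)))) := by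
  have := two_lt_ratio hk hL hT
  rw [Real.lt_logb_iff_rpow_lt (by norm_num) (by linarith)]
  simpa using this

lemma logb_logb_ratio_pos {k T : ℕ} {δ : ℝ} (hk : 0 < k) (hL : 0 < Real.log (k / δ))
    (hT : beta * k * Real.log (k / δ) < T) :
    0 < Real.logb 2 (Real.logb 2 ((T : ℝ) / (slackConst ^ 2 * (k * Real.log (k / δ))))) :=
  Real.logb_pos (by norm_num) (one_lt_logb_ratio hk hL hT)

lemma two_le_potential_cmy {k T : ℕ} (δ : ℝ) (hk : 0 < k) (hT : 4 * k ≤ T) :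
    2 ≤ potential k δ .cmy T := by
  have hpos := log_four_thirds_pos
  have : 0 ≤ Real.log ((T : ℝ) / (4 * k)) := by
    apply Real.log_nonneg
    rw [le_div_iff₀ (by positivity)]
    rw [one_mul]; exact_mod_cast hT
  simp only [potential]
  have := div_nonneg this hpos.le
  linarith

lemma one_le_potential {k : ℕ} {μ : Fin k → ℝ} {δ : ℝ} {s : State k} (hk : 0 < k)
    (hL : 0 < Real.log (k / δ)) (h : RoundInv μ δ s s.phase) :
    1 ≤ potential k δ s.phase s.threshold := by
  cases hp : s.phase <;> rw [hp] at h
  · simp [potential]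
  · linarith [two_le_potential_cmy δ hk h.1]
  · have := logb_logb_ratio_pos hk hL h.1
    have := two_le_tailRounds k δ
    simp only [potential]; linarith
  · simp [potential]

lemma potential_cmy_le {k T : ℕ} {δ : ℝ} (hk : 0 < k) (hT0 : 0 < T)
    (hT : (T : ℝ) ≤ beta * k * Real.log (k / δ)) : potential k δ .cmy T ≤ tailRounds k δ := by
  have hpos := log_four_thirds_pos
  have hk' : (0 : ℝ) < k := by exact_mod_cast hk
  have hT' : (0 : ℝ) < T := by exact_mod_cast hT0
  simp only [potential, tailRounds]
  gcongr
  refine le_max_of_le_right (Real.log_le_log (by positivity) ?_)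
  rw [div_le_iff₀ (by positivity)]
  linarith

/-- Which potentials are possible after a static-slack round, or at the beginning. -/
lemma nextPhase_staticSlack_cases {k T : ℕ} {δ : ℝ} (hk : 0 < k) (hT : 0 < T) :
    potential k δ (nextPhase k δ .staticSlack T) T ≤ tailRounds k δ ∨
    (nextPhase k δ .staticSlack T = .staticSlack ∧ beta * k * Real.log (k / δ) < T) := by
  unfold nextPhase
  split_ifs with h1 h2 h3 h4 h5
  · omega
  · simp at h2
  · simp at h2
  · left; simp only [potential]; linarith [two_le_tailRounds k δ]
  · exact Or.inl (potential_cmy_le hk hT h5)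
  · exact Or.inr ⟨rfl, not_le.mp h5⟩

/-- The potential drops by one when a CMY round is followed by another round. -/
lemma potential_cmy_drop {k T m : ℕ} {δ : ℝ} (hk : 0 < k) (hT : 4 * k ≤ T) (hm : 0 < m)
    (h : 4 * m ≤ 3 * T) :
    potential k δ (nextPhase k δ .cmy m) m + 1 ≤ potential k δ .cmy T := by
  unfold nextPhase
  split_ifs with h1 h2 h3
  · omega
  · have := two_le_potential_cmy δ hk hT
    simp only [potential] at this ⊢
    linarith
  · have hpos := log_four_thirds_pos
    have hk' : (0 : ℝ) < k := by exact_mod_cast hk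
    have hm' : (0 : ℝ) < m := by exact_mod_cast hm
    have h' : (4 : ℝ) * m ≤ 3 * T := by exact_mod_cast h
    have hle : Real.log (m / (4 * k)) + Real.log (4 / 3) ≤ Real.log (T / (4 * k)) := by
      rw [← Real.log_mul (by positivity) (by norm_num)]
      refine Real.log_le_log (by positivity) ?_
      rw [div_mul_eq_mul_div]
      gcongr
      linarith
    simp only [potential]
    have := div_le_div_of_nonneg_right hle hpos.le
    rw [add_div, div_self hpos.ne'] at this
    linarith
  all_goals exact absurd rfl h2

/-- The potential drops by one when a good static-slack round is followed by another round. -/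
lemma potential_staticSlack_drop {k T m : ℕ} {δ : ℝ} (hk : 0 < k) (hL : 0 < Real.log (k / δ))
    (hT : beta * k * Real.log (k / δ) < T) (hm : 0 < m) (h : (m : ℝ) < T - target k δ T) :
    potential k δ (nextPhase k δ .staticSlack m) m + 1 ≤ potential k δ .staticSlack T := by
  have hpos := logb_logb_ratio_pos hk hL hT
  rcases nextPhase_staticSlack_cases (δ := δ) hk hm with h1 | ⟨h1, h2⟩
  · simp only [potential] at h1 ⊢
    linarith
  · have hc := slackConst_pos
    have hy := one_lt_logb_ratio hk hL hT
    have hy' := one_lt_logb_ratio hk hL h2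
    have hr := two_lt_ratio hk hL hT
    have hr' := two_lt_ratio hk hL h2
    rw [h1]
    simp only [potential]
    -- The normalisation by `c²kL` turns `m² ≤ c²kTL` into the clean recursion `y'² ≤ y`.
    have hsq : ((m : ℝ) / (slackConst ^ 2 * (k * Real.log (k / δ)))) ^ 2
        ≤ (T : ℝ) / (slackConst ^ 2 * (k * Real.log (k / δ))) := by
      unfold target at h
      set L := Real.log (k / δ)
      have hm2 : (m : ℝ) ^ 2 ≤ slackConst ^ 2 * (k * T * L) := by
        have h0 : (0 : ℝ) ≤ k * T * L := by positivity
        calc (m : ℝ) ^ 2 ≤ (slackConst * Real.sqrt (k * T * L)) ^ 2 := by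
              gcongr; linarith
          _ = _ := by rw [mul_pow, Real.sq_sqrt h0]
      have hk' : (0 : ℝ) < k := by exact_mod_cast hk
      rw [div_pow, div_le_div_iff₀ (by positivity) (by positivity)]
      calc (m : ℝ) ^ 2 * (slackConst ^ 2 * (k * L))
          ≤ slackConst ^ 2 * (k * T * L) * (slackConst ^ 2 * (k * L)) := by gcongr
        _ = _ := by ring
    set y := (T : ℝ) / (slackConst ^ 2 * (k * Real.log (k / δ)))
    set y' := (m : ℝ) / (slackConst ^ 2 * (k * Real.log (k / δ)))
    have h3 : 2 * Real.logb 2 y' ≤ Real.logb 2 y := by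
      have := Real.logb_le_logb_of_le (b := 2) (by norm_num) (by positivity) hsq
      rwa [Real.logb_pow] at this
    have h4 : Real.logb 2 (Real.logb 2 y') + 1 ≤ Real.logb 2 (Real.logb 2 y) := by
      have := Real.logb_le_logb_of_le (b := 2) (by norm_num) (by positivity) h3
      rw [Real.logb_mul (by norm_num) (by positivity), Real.logb_self_eq_one (by norm_num)] at this
      linarith
    linarith

/-! ### Good rounds and the bound on the number of rounds. -/

/-- In the round that starts with item `a`, no slack is reached by the first `⌊t⌋` items. -/
def GoodFrom {k : ℕ} (μ : Fin k → ℝ) (δ : ℝ) (N : ℕ) (x : ℕ → Fin k) (a : ℕ) : Prop :=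
  ∀ i, (((Finset.Ico a (a + ⌊target k δ (N - a)⌋₊)).filter fun j => x j = i).card : ℝ)
    < slack μ δ (N - a) i

/-- A static-slack round has just been started. -/
def StaticStart {k : ℕ} (s : State k) : Prop :=
  s.phase = .staticSlack ∧ s.counter = fun _ => 0

/-- Counters only grow, so goodness at item `⌊t⌋` of the round excludes any earlier notification as
well. -/
lemma RunInv.target_lt {k N n a : ℕ} {μ : Fin k → ℝ} {δ : ℝ} {x : ℕ → Fin k} {s : State k}
    (h : RunInv μ δ N x n s a) (hg : GoodFrom μ δ N x a)
    (hn : notifies μ δ s.threshold (x n) (s.counter (x n) + 1) .staticSlack) :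
    target k δ s.threshold < (∑ j, s.counter j + 1 : ℕ) := by
  have hT : N - a = s.threshold := by have := h.start_add_threshold; omega
  have h3 := h.start_add
  by_contra hle
  rw [not_lt] at hle
  have hfl := Nat.le_floor hle
  have h1 := hg (x n)
  rw [hT] at h1
  have h2 : s.counter (x n) + 1
      ≤ ((Finset.Ico a (a + ⌊target k δ s.threshold⌋₊)).filter fun j => x j = x n).card := by
    have : s.counter (x n) + 1 = ((Finset.Ico a (n + 1)).filter fun j => x j = x n).card := by
      rw [h.counter_eq, Finset.card_filter, Finset.card_filter,
        Finset.sum_Ico_succ_top (by omega)]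
      simp
    rw [this]
    apply Finset.card_le_card
    apply Finset.filter_subset_filter
    apply Finset.Ico_subset_Ico_right
    omega
  change slack μ δ s.threshold (x n) ≤ ((s.counter (x n) + 1 : ℕ) : ℝ) at hn
  have : ((s.counter (x n) + 1 : ℕ) : ℝ) ≤ _ := Nat.cast_le.mpr h2
  linarith

/-- If the first `R` static-slack rounds are good, the number of rounds obeys the potential. -/
theorem rounds_add_potential_le {k N : ℕ} {μ : Fin k → ℝ} {δ R : ℝ} (hk : 0 < k) (hN : 0 < N)
    (hL : 0 < Real.log (k / δ)) (hμ : ∀ i, 0 ≤ μ i) (hsum : ∑ i, μ i = 1) (x : ℕ → Fin k)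
    (hR : potential k δ (nextPhase k δ .staticSlack N) N - tailRounds k δ ≤ R)
    (hgood : ∀ a < N, StaticStart (run μ δ N x a) → ((run μ δ N x a).rounds : ℝ) ≤ R →
      GoodFrom μ δ N x a) (n : ℕ) :
    ((run μ δ N x n).rounds : ℝ) + potential k δ (run μ δ N x n).phase (run μ δ N x n).threshold
      ≤ 1 + potential k δ (nextPhase k δ .staticSlack N) N := by
  induction n with
  | zero => simp [run, startRound, hN.ne']
  | succ n ih =>
    have hstep : run μ δ N x (n + 1) = step μ δ (run μ δ N x n) (x n) := rfl
    rw [hstep]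
    rcases run_invariant hk hN hL hμ hsum x n with ⟨ha, hn, hm⟩ | ⟨ha, a, h⟩
    · rwa [step_alarm _ _ _ _ ha]
    · rcases step_cases μ δ _ (x n) ha with ⟨d, _, he, h1, h2⟩ | ⟨he, hn, hq⟩
      · rwa [he]
      · rw [he, finish]
        have hone := one_le_potential hk hL h.roundInv
        have hlt := h.lt hk hL hμ hsum ha
        generalize hs : run μ δ N x n = s at *
        have hlt' := h.roundInv.sum_lt hk hL hμ hsum ha
        have hinv := h.roundInv
        by_cases hT : s.threshold - (∑ j, s.counter j + 1) = 0
        · rw [hT]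
          simp only [startRound, if_true, nextPhase_eq_alarm_iff.mpr]
          have : potential k δ .alarm 0 = 1 := rfl
          linarith
        · suffices hd : potential k δ (nextPhase k δ s.phase (s.threshold - (∑ j, s.counter j + 1)))
              (s.threshold - (∑ j, s.counter j + 1)) + 1 ≤ potential k δ s.phase s.threshold by
            simp only [startRound, hT, if_false]
            push_cast
            linarith
          cases hp : s.phase <;> rw [hp] at hn hq hinv
          -- The straightforward quota is the whole threshold, so no items can remain.
          · have hA := hinv.2.1
            simp only [quota] at hq
            omega
          -- With slack `s ≥ 1`, `T < 2k(s + 1) ≤ 4ks`, so the `ks` or more items received exceed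
          -- `T/4`.
          · have hA := hinv.cmy_finish hn hq
            have hpos := cmySlack_pos hk hinv.1
            have hB : s.threshold < 2 * k * (cmySlack k s.threshold + 1) :=
              Nat.lt_mul_div_succ _ (by omega)
            apply potential_cmy_drop hk hinv.1 (Nat.pos_of_ne_zero hT)
            have : k ≤ cmySlack k s.threshold * k := Nat.le_mul_of_pos_left _ hpos
            have : 2 * k * (cmySlack k s.threshold + 1) = 2 * (cmySlack k s.threshold * k) + 2 * k := by
              ring
            omega
          -- No circularity: the induction hypothesis, with a static potential above `tailRounds +
          -- 1`, already places this round among the first `R`, where goodness is assumed.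
          · have hrounds : (s.rounds : ℝ) ≤ R := by
              have := logb_logb_ratio_pos hk hL hinv.1
              rw [hp] at ih
              simp only [potential] at ih hR
              linarith
            have han : a < N := by
              have := h.start_add
              omega
            have hg := hgood a han ⟨h.phase_start.trans hp, h.counter_start⟩
              (by rw [h.rounds_start]; exact hrounds)
            have := h.target_lt hg hn
            apply potential_staticSlack_drop hk hL hinv.1 (Nat.pos_of_ne_zero hT)
            rw [Nat.cast_sub (by omega)]
            linarith
          · exact absurd hp ha

/-- Each start of a static-slack round increases the number of rounds. -/
lemma rounds_succ {k N : ℕ} {μ : Fin k → ℝ} {δ : ℝ} (x : ℕ → Fin k) (n : ℕ) :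
    (run μ δ N x n).rounds ≤ (run μ δ N x (n + 1)).rounds ∧
    (StaticStart (run μ δ N x (n + 1)) →
      (run μ δ N x (n + 1)).rounds = (run μ δ N x n).rounds + 1) := by
  have hstep : run μ δ N x (n + 1) = step μ δ (run μ δ N x n) (x n) := rfl
  rw [hstep]
  by_cases ha : (run μ δ N x n).phase = .alarm
  · rw [step_alarm _ _ _ _ ha]
    exact ⟨le_rfl, fun h => by simp [h.1] at ha⟩
  · rcases step_cases μ δ _ (x n) ha with ⟨d, _, he, h1, h2⟩ | ⟨he, hn, hq⟩
    · rw [he]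
      refine ⟨le_rfl, fun h => ?_⟩
      -- The counter just increased is nonzero, so this is not the start of a round.
      have := congrFun h.2 (x n)
      simp [advance] at this
    · rw [he, finish]
      constructor
      · simp only [startRound]; split_ifs <;> omega
      · intro h
        have h0 := h.1
        simp only [startRound] at h0 ⊢
        split_ifs with hT
        · simp [nextPhase_eq_alarm_iff.mpr hT] at h0
        · rfl

open Classical in
/-- There are at most `R` static-slack rounds among the first `R` rounds. -/
lemma sum_staticStart_le {k N : ℕ} {μ : Fin k → ℝ} {δ : ℝ} (R : ℕ) (x : ℕ → Fin k) (n : ℕ) :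
    ∑ m ∈ Finset.range n,
      (if StaticStart (run μ δ N x m) ∧ (run μ δ N x m).rounds ≤ R then 1 else 0) ≤ R := by
  -- The induction needs the minimum with the current round number, which grows by one at every
  -- counted start.
  suffices h : ∀ n, ∑ m ∈ Finset.range (n + 1),
      (if StaticStart (run μ δ N x m) ∧ (run μ δ N x m).rounds ≤ R then 1 else 0)
        ≤ min R (run μ δ N x n).rounds by
    cases n with
    | zero => simp
    | succ n => exact (h n).trans (min_le_left _ _)
  intro n
  induction n with
  | zero =>
    rw [Finset.sum_range_one]
    split_ifs with h
    · have h0 := h.1.1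
      have : (run μ δ N x 0).rounds = 1 := by
        simp only [run, startRound] at h0 ⊢
        split_ifs with hT
        · simp [nextPhase_eq_alarm_iff.mpr hT] at h0
        · rfl
      have := h.2
      omega
    · omega
  | succ n ih =>
    rw [Finset.sum_range_succ]
    have h1 := rounds_succ (μ := μ) (δ := δ) (N := N) x n
    split_ifs with h
    · have := h1.2 h.1
      have := h.2
      omega
    · omega

/-! ### Bernstein's inequality: analytic estimates. -/

/-- Since `(n + 2)! ≥ 2·3ⁿ`, the exponential series from degree two on is dominated by a geometric
series of ratio `x/3`. -/
lemma exp_le_of_nonneg_of_lt_three {x : ℝ} (h0 : 0 ≤ x) (h3 : x < 3) :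
    Real.exp x ≤ 1 + x + x ^ 2 / (2 * (1 - x / 3)) := by
  have hexp : HasSum (fun n : ℕ => x ^ n / (n.factorial : ℝ)) (Real.exp x) := by
    rw [Real.exp_eq_exp_ℝ]
    exact NormedSpace.expSeries_div_hasSum_exp x
  have htail := (hasSum_nat_add_iff' 2).mpr hexp
  have hgeo := (hasSum_geometric_of_lt_one (r := x / 3) (by positivity) (by linarith)).mul_left
    (x ^ 2 / 2)
  have hle := hasSum_le (fun n => ?_) htail hgeo
  · simp only [Finset.sum_range_succ, Finset.sum_range_zero] at hle
    norm_num at hle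
    have : x ^ 2 / (2 * (1 - x / 3)) = x ^ 2 / 2 * (1 - x / 3)⁻¹ := by
      rw [← div_div, div_eq_mul_inv (x ^ 2 / 2)]
    linarith
  · have hf : (2 * 3 ^ n : ℝ) ≤ ((n + 2).factorial : ℝ) := by
      have := Nat.factorial_mul_pow_le_factorial (m := 2) (n := n)
      rw [add_comm n 2]
      exact_mod_cast this
    calc x ^ (n + 2) / ((n + 2).factorial : ℝ) ≤ x ^ (n + 2) / (2 * 3 ^ n) := by gcongr
      _ = x ^ 2 / 2 * (x / 3) ^ n := by rw [div_pow, pow_add]; field_simp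

/-- Invert the quadratic lower bound for `exp (-x)`, using `(1 + x + x²/2)(1 - x + x²/2) = 1 + x⁴/4
≥ 1`. -/
lemma exp_le_of_nonpos {x : ℝ} (h0 : x ≤ 0) : Real.exp x ≤ 1 + x + x ^ 2 / 2 := by
  have h1 := Real.quadratic_le_exp_of_nonneg (x := -x) (by linarith)
  have h2 : Real.exp x * Real.exp (-x) = 1 := by rw [← Real.exp_add]; simp
  have h3 := Real.exp_pos x
  have h4 : 0 < 1 - x + x ^ 2 / 2 := by nlinarith
  have h5 : Real.exp x * (1 - x + x ^ 2 / 2) ≤ 1 := by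
    calc Real.exp x * (1 - x + x ^ 2 / 2) ≤ Real.exp x * Real.exp (-x) := by
          gcongr; nlinarith
      _ = 1 := h2
  refine le_of_mul_le_mul_right (h5.trans ?_) h4
  nlinarith [sq_nonneg (x ^ 2)]

lemma exp_le_quadratic {h x : ℝ} (h0 : 0 ≤ h) (h3 : h < 3) (hx : x ≤ h) :
    Real.exp x ≤ 1 + x + x ^ 2 * (1 / (2 * (1 - h / 3))) := by
  have hpos : 0 < 2 * (1 - h / 3) := by linarith
  rcases le_total x 0 with hx0 | hx0
  · have h1 : (1 : ℝ) / 2 ≤ 1 / (2 * (1 - h / 3)) := by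
      apply one_div_le_one_div_of_le hpos; linarith
    have := exp_le_of_nonpos hx0
    nlinarith [mul_le_mul_of_nonneg_left h1 (sq_nonneg x)]
  · have h1 : (1 : ℝ) / (2 * (1 - x / 3)) ≤ 1 / (2 * (1 - h / 3)) := by
      apply one_div_le_one_div_of_le hpos; linarith
    have := exp_le_of_nonneg_of_lt_three hx0 (hx.trans_lt h3)
    have h2 := mul_le_mul_of_nonneg_left h1 (sq_nonneg x)
    rw [mul_one_div] at h2
    linarith

/-- Bernstein's bound for the moment generating function of a Bernoulli variable. -/
lemma bernoulli_mgf_le {p h : ℝ} (hp0 : 0 ≤ p) (hp1 : p ≤ 1) (h0 : 0 ≤ h) (h3 : h < 3) :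
    1 + p * (Real.exp h - 1)
      ≤ Real.exp (h * p + p * (1 - p) * h ^ 2 * (1 / (2 * (1 - h / 3)))) := by
  set φ := 1 / (2 * (1 - h / 3)) with hφ
  have h1 := exp_le_quadratic (x := h * (1 - p)) h0 h3 (by nlinarith)
  have h2 := exp_le_quadratic (x := -(h * p)) h0 h3 (by nlinarith)
  have hq : 0 ≤ 1 - p := by linarith
  -- For the centred variable the linear terms cancel and the quadratic ones add up to the variance
  -- `p(1 - p)`.
  have h3 : p * Real.exp (h * (1 - p)) + (1 - p) * Real.exp (-(h * p))
      ≤ Real.exp (p * (1 - p) * h ^ 2 * φ) := by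
    have := Real.add_one_le_exp (p * (1 - p) * h ^ 2 * φ)
    have := mul_le_mul_of_nonneg_left h1 hp0
    have := mul_le_mul_of_nonneg_left h2 hq
    rw [← hφ] at *
    nlinarith
  have h4 : 1 + p * (Real.exp h - 1)
      = Real.exp (h * p) * (p * Real.exp (h * (1 - p)) + (1 - p) * Real.exp (-(h * p))) := by
    have e1 : Real.exp (h * p) * Real.exp (h * (1 - p)) = Real.exp h := by
      rw [← Real.exp_add]; congr 1; ring
    have e2 : Real.exp (h * p) * Real.exp (-(h * p)) = 1 := by
      rw [← Real.exp_add]; simp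
    linear_combination (-p) * e1 - (1 - p) * e2
  rw [h4, Real.exp_add]
  gcongr

/-- The choice of the parameter in Bernstein's inequality, with `a² = V` and `b² = 2 L`. -/
lemma bernstein_exponent {a b : ℝ} (ha : 0 ≤ a) (hb : 0 < b) :
    ∃ h : ℝ, 0 ≤ h ∧ h < 3 ∧
      -h * (a * b + b ^ 2 / 3) + a ^ 2 * h ^ 2 * (1 / (2 * (1 - h / 3))) ≤ -(b ^ 2 / 2) := by
  have hd : 0 < a + 2 * b / 3 := by positivity
  have he : 0 < a + b / 3 := by positivity
  refine ⟨b / (a + 2 * b / 3), by positivity, ?_, ?_⟩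
  · rw [div_lt_iff₀ hd]; linarith
  · have h1 : 1 - b / (a + 2 * b / 3) / 3 = (a + b / 3) / (a + 2 * b / 3) := by
      field_simp; ring
    rw [h1]
    have h2 : -(b / (a + 2 * b / 3)) * (a * b + b ^ 2 / 3)
        + a ^ 2 * (b / (a + 2 * b / 3)) ^ 2 * (1 / (2 * ((a + b / 3) / (a + 2 * b / 3))))
        = b ^ 2 * (a ^ 2 - 2 * (a + b / 3) ^ 2) / (2 * ((a + b / 3) * (a + 2 * b / 3))) := by
      field_simp; ring
    rw [h2, div_le_iff₀ (by positivity)]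
    -- After clearing denominators the two sides differ by exactly `ab³/3`.
    have : 0 ≤ a * b ^ 3 := by positivity
    nlinarith

/-! ### Probability that a round is bad. -/

/-- Events determined by independent discrete variables are measurable and independent. -/
lemma indep_of_saturated {Ω α β : Type*} [MeasurableSpace Ω] {P : Measure Ω}
    [MeasurableSpace α] [MeasurableSpace β]
    [DiscreteMeasurableSpace α] [DiscreteMeasurableSpace β] {f : Ω → α} {g : Ω → β}
    (hfg : IndepFun f g P) {A B : Set Ω}
    (hA : ∀ ω ω', f ω = f ω' → ω ∈ A → ω' ∈ A) (hB : ∀ ω ω', g ω = g ω' → ω ∈ B → ω' ∈ B) :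
    P.real (A ∩ B) = P.real A * P.real B := by
  have hA' : A = f ⁻¹' (f '' A) := by
    refine Set.Subset.antisymm (Set.subset_preimage_image _ _) ?_
    rintro ω ⟨ω', h, e⟩
    exact hA _ _ e h
  have hB' : B = g ⁻¹' (g '' B) := by
    refine Set.Subset.antisymm (Set.subset_preimage_image _ _) ?_
    rintro ω ⟨ω', h, e⟩
    exact hB _ _ e h
  have := hfg.measure_inter_preimage_eq_mul (f '' A) (g '' B) (MeasurableSet.of_discrete)
    (MeasurableSet.of_discrete)
  rw [← hA', ← hB'] at this
  simp [Measure.real, this, ENNReal.toReal_mul]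

section Probability

variable {Ω : Type*} [MeasurableSpace Ω] {P : Measure Ω} {k : ℕ}
  {X : ℕ → Ω → Fin k}

lemma mgf_hit [IsProbabilityMeasure P] {μ : Fin k → ℝ} (hX : ∀ j, Measurable (X j))
    (hlaw : ∀ j i, P.real {ω | X j ω = i} = μ i) (i : Fin k) (j : ℕ) (h : ℝ) :
    mgf (fun ω => if X j ω = i then (1 : ℝ) else 0) P h = 1 + μ i * (Real.exp h - 1) := by
  have hms : MeasurableSet {ω | X j ω = i} := hX j (measurableSet_singleton i)
  have : (fun ω => Real.exp (h * if X j ω = i then (1 : ℝ) else 0))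
      = fun ω => 1 + {ω | X j ω = i}.indicator 1 ω * (Real.exp h - 1) := by
    funext ω
    by_cases hω : X j ω = i <;> simp [hω]
  rw [mgf, this, integral_add (integrable_const _), integral_mul_const, integral_indicator_one hms,
    hlaw]
  · simp
  · exact ((integrable_const (1 : ℝ)).indicator hms).mul_const _

/-- Bernstein's inequality for the number of items received by player `i`. -/
lemma count_tail [IsProbabilityMeasure P] {μ : Fin k → ℝ} (hX : ∀ j, Measurable (X j)) (hind : iIndepFun X P)
    (hlaw : ∀ j i, P.real {ω | X j ω = i} = μ i) (i : Fin k) (s : Finset ℕ) {t L : ℝ}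
    (hs : (s.card : ℝ) ≤ t) (hL : 0 < L) :
    P.real {ω | μ i * t + Real.sqrt (2 * t * μ i * (1 - μ i) * L) + 2 / 3 * L
      ≤ ((s.filter fun j => X j ω = i).card : ℝ)} ≤ Real.exp (-L) := by
  have hp0 : 0 ≤ μ i := hlaw 0 i ▸ measureReal_nonneg
  have hp1 : μ i ≤ 1 := hlaw 0 i ▸ measureReal_le_one
  have hq : 0 ≤ 1 - μ i := by linarith
  have ht : 0 ≤ t := le_trans (by positivity) hs
  set p := μ i
  set V := t * p * (1 - p) with hV
  have hV0 : 0 ≤ V := by positivity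
  obtain ⟨h, h0, h3, hexp⟩ := bernstein_exponent (Real.sqrt_nonneg V)
    (Real.sqrt_pos.mpr (by positivity : 0 < 2 * L))
  rw [Real.sq_sqrt hV0, Real.sq_sqrt (by positivity), ← Real.sqrt_mul hV0] at hexp
  set φ := 1 / (2 * (1 - h / 3)) with hφ
  have hφ0 : 0 ≤ φ := by
    have : 0 < 1 - h / 3 := by linarith
    positivity
  let Y : ℕ → Ω → ℝ := fun j ω => if X j ω = i then 1 else 0
  have hYm : ∀ j, Measurable (Y j) := fun j =>
    Measurable.ite (hX j (measurableSet_singleton i)) measurable_const measurable_const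
  have hYind : iIndepFun Y P :=
    hind.comp (fun _ y => if y = i then (1 : ℝ) else 0) fun _ => measurable_of_finite _
  have hcard : ∀ ω, ((s.filter fun j => X j ω = i).card : ℝ) = (∑ j ∈ s, Y j) ω := by
    intro ω
    simp [Y, Finset.sum_apply]
  simp only [hcard]
  set lam := p * t + Real.sqrt (2 * t * p * (1 - p) * L) + 2 / 3 * L
  have hbound : ∀ ω, |(∑ j ∈ s, Y j) ω| ≤ s.card := by
    intro ω
    rw [← hcard, abs_of_nonneg (by positivity)]
    exact_mod_cast Finset.card_filter_le _ _
  have hint : Integrable (fun ω => Real.exp (h * (∑ j ∈ s, Y j) ω)) P := by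
    apply Integrable.of_bound (C := Real.exp (h * s.card))
    · simp only [Finset.sum_apply]
      exact (((Finset.measurable_sum s fun j _ => hYm j).const_mul h).exp).aestronglyMeasurable
    · filter_upwards with ω
      rw [Real.norm_eq_abs, Real.abs_exp]
      gcongr
      exact (le_abs_self _).trans (hbound ω)
  refine (measure_ge_le_exp_mul_mgf lam h0 hint).trans ?_
  rw [hYind.mgf_sum hYm]
  have hprod : ∏ j ∈ s, mgf (Y j) P h
      ≤ Real.exp (h * p + p * (1 - p) * h ^ 2 * φ) ^ s.card := by
    rw [← Finset.prod_const]
    apply Finset.prod_le_prod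
    · intro j _; exact mgf_nonneg
    · intro j _
      rw [mgf_hit hX hlaw]
      exact bernoulli_mgf_le hp0 hp1 h0 h3
  calc Real.exp (-h * lam) * ∏ j ∈ s, mgf (Y j) P h
      ≤ Real.exp (-h * lam) * Real.exp (h * p + p * (1 - p) * h ^ 2 * φ) ^ s.card := by gcongr
    _ = Real.exp (-h * lam + s.card * (h * p + p * (1 - p) * h ^ 2 * φ)) := by
        rw [← Real.exp_nat_mul, ← Real.exp_add]
    _ ≤ Real.exp (-h * lam + t * (h * p + p * (1 - p) * h ^ 2 * φ)) := by gcongr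
    _ ≤ Real.exp (-L) := by
        rw [Real.exp_le_exp]
        have e : 2 * t * p * (1 - p) * L = V * (2 * L) := by rw [hV]; ring
        simp only [lam, e]
        rw [hV] at hexp ⊢
        linarith

/-- A static-slack round starting with item `a` is bad with probability at most `δ`. -/
lemma not_goodFrom_le [IsProbabilityMeasure P] {μ : Fin k → ℝ} {δ : ℝ} {N a : ℕ} (hk : 0 < k) (h0 : 0 < δ) (h1 : δ < 1)
    (hX : ∀ j, Measurable (X j)) (hind : iIndepFun X P)
    (hlaw : ∀ j i, P.real {ω | X j ω = i} = μ i)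
    (ha : beta * k * Real.log (k / δ) < (N - a : ℕ)) :
    P.real {ω | ¬ GoodFrom μ δ N (fun j => X j ω) a} ≤ δ := by
  have hL := log_div_pos hk h0 h1
  have ht := target_pos hL ha
  have hk' : (0 : ℝ) < k := by exact_mod_cast hk
  have hset : {ω | ¬ GoodFrom μ δ N (fun j => X j ω) a} = ⋃ i, {ω | slack μ δ (N - a) i
      ≤ (((Finset.Ico a (a + ⌊target k δ (N - a)⌋₊)).filter fun j => X j ω = i).card : ℝ)} := by
    ext ω
    simp [GoodFrom]
  rw [hset]
  refine (measureReal_iUnion_fintype_le _).trans ?_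
  have hi : ∀ i, P.real {ω | slack μ δ (N - a) i
      ≤ (((Finset.Ico a (a + ⌊target k δ (N - a)⌋₊)).filter fun j => X j ω = i).card : ℝ)}
      ≤ δ / k := by
    intro i
    have := count_tail hX hind hlaw i (Finset.Ico a (a + ⌊target k δ (N - a)⌋₊))
      (t := target k δ (N - a)) (by simpa using Nat.floor_le ht.le) hL
    -- `exp(-L) = δ/k`, which the union over `k` players turns into `δ`.
    rwa [Real.exp_neg, Real.exp_log (by positivity), inv_div] at this
  refine (Finset.sum_le_sum fun i _ => hi i).trans ?_
  simp
  field_simp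
  exact le_rfl

lemma run_congr {μ : Fin k → ℝ} {δ : ℝ} {N : ℕ} {x y : ℕ → Fin k} {n : ℕ}
    (h : ∀ j < n, x j = y j) : run μ δ N x n = run μ δ N y n := by
  induction n with
  | zero => rfl
  | succ n ih =>
    rw [run, run, ih fun j hj => h j (by omega), h n (by omega)]

/-- The event that item number `n` is the first one of one of the first `R` rounds, and that this
is a static-slack round. -/
def startEvent (X : ℕ → Ω → Fin k) (μ : Fin k → ℝ) (δ : ℝ) (N R n : ℕ) : Set Ω :=
  {ω | StaticStart (run μ δ N (fun j => X j ω) n) ∧ (run μ δ N (fun j => X j ω) n).rounds ≤ R}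

lemma measurableSet_startEvent {μ : Fin k → ℝ} {δ : ℝ} {N R n : ℕ} (hX : ∀ j, Measurable (X j)) :
    MeasurableSet (startEvent X μ δ N R n) := by
  let f : Ω → (Finset.range n → Fin k) := fun ω j => X j ω
  have hf : Measurable f := measurable_pi_lambda _ fun j => hX j
  have : startEvent X μ δ N R n = f ⁻¹' (f '' startEvent X μ δ N R n) := by
    refine Set.Subset.antisymm (Set.subset_preimage_image _ _) ?_
    rintro ω ⟨ω', h, e⟩
    have hc : run μ δ N (fun j => X j ω) n = run μ δ N (fun j => X j ω') n :=
      run_congr fun j hj => (congrFun e ⟨j, by simpa using hj⟩).symm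
    simpa [startEvent, hc] using h
  rw [this]
  exact hf MeasurableSet.of_discrete

/-- The past decides whether a round starts at item `n`, the items from `n` on decide its goodness.
This replaces a strong Markov argument. -/
lemma startEvent_inter_bad {μ : Fin k → ℝ} {δ : ℝ} {N R n : ℕ} (hX : ∀ j, Measurable (X j))
    (hind : iIndepFun X P) :
    P.real (startEvent X μ δ N R n ∩ {ω | ¬ GoodFrom μ δ N (fun j => X j ω) n})
      = P.real (startEvent X μ δ N R n) * P.real {ω | ¬ GoodFrom μ δ N (fun j => X j ω) n} := by
  have hdisj : Disjoint (Finset.range n) (Finset.Ico n (n + ⌊target k δ (N - n)⌋₊)) := by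
    rw [Finset.disjoint_left]
    intro j h1 h2
    simp at h1 h2
    omega
  refine indep_of_saturated (hind.indepFun_finset _ _ hdisj hX) ?_ ?_
  · intro ω ω' e h
    have hc : run μ δ N (fun j => X j ω) n = run μ δ N (fun j => X j ω') n :=
      run_congr fun j hj => congrFun e ⟨j, by simpa using hj⟩
    simpa [startEvent, hc] using h
  · intro ω ω' e h hg
    refine h fun i => ?_
    convert hg i using 3
    refine Finset.filter_congr fun j hj => ?_
    have hj' : X j ω = X j ω' := congrFun e ⟨j, hj⟩
    simp only [hj']

lemma sum_startEvent_le [IsProbabilityMeasure P] {μ : Fin k → ℝ} {δ : ℝ} {N R : ℕ} (hX : ∀ j, Measurable (X j)) (n : ℕ) :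
    ∑ m ∈ Finset.range n, P.real (startEvent X μ δ N R m) ≤ R := by
  classical
  have h1 : ∀ m, P.real (startEvent X μ δ N R m)
      = ∫ ω, (startEvent X μ δ N R m).indicator 1 ω ∂P := fun m =>
    (integral_indicator_one (measurableSet_startEvent hX)).symm
  have hint : ∀ m, Integrable ((startEvent X μ δ N R m).indicator (1 : Ω → ℝ)) P := fun m =>
    (integrable_const (1 : ℝ)).indicator (measurableSet_startEvent hX)
  simp only [h1]
  rw [← integral_finsetSum _ fun m _ => hint m]
  calc ∫ ω, ∑ m ∈ Finset.range n, (startEvent X μ δ N R m).indicator 1 ω ∂P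
      ≤ ∫ _, (R : ℝ) ∂P := by
        refine integral_mono (integrable_finsetSum _ fun m _ => hint m) (integrable_const _) ?_
        intro ω
        have := sum_staticStart_le (μ := μ) (δ := δ) (N := N) R (fun j => X j ω) n
        have h2 : ((∑ m ∈ Finset.range n, (if StaticStart (run μ δ N (fun j => X j ω) m) ∧
            (run μ δ N (fun j => X j ω) m).rounds ≤ R then 1 else 0) : ℕ) : ℝ) ≤ R := by
          exact_mod_cast this
        push_cast at h2
        refine le_trans (le_of_eq ?_) h2
        refine Finset.sum_congr rfl fun m _ => ?_
        simp [startEvent, Set.indicator_apply]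
    _ = R := by simp

/-- The probability that one of the first `R` static-slack rounds is bad. -/
theorem exists_bad_le [IsProbabilityMeasure P] {μ : Fin k → ℝ} {δ q : ℝ} {N R : ℕ} (hk : 0 < k) (hN : 0 < N)
    (hL : 0 < Real.log (k / δ)) (hμ : ∀ i, 0 ≤ μ i) (hsum : ∑ i, μ i = 1)
    (hX : ∀ j, Measurable (X j)) (hind : iIndepFun X P) (hq : 0 ≤ q)
    (hbad : ∀ a, beta * k * Real.log (k / δ) < (N - a : ℕ) →
      P.real {ω | ¬ GoodFrom μ δ N (fun j => X j ω) a} ≤ q) :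
    P.real {ω | ∃ a < N, StaticStart (run μ δ N (fun j => X j ω) a) ∧
      (run μ δ N (fun j => X j ω) a).rounds ≤ R ∧ ¬ GoodFrom μ δ N (fun j => X j ω) a}
      ≤ q * R := by
  have hset : {ω | ∃ a < N, StaticStart (run μ δ N (fun j => X j ω) a) ∧
      (run μ δ N (fun j => X j ω) a).rounds ≤ R ∧ ¬ GoodFrom μ δ N (fun j => X j ω) a}
      = ⋃ a ∈ Finset.range N,
        startEvent X μ δ N R a ∩ {ω | ¬ GoodFrom μ δ N (fun j => X j ω) a} := by
    ext ω
    simp only [startEvent, Set.mem_ofPred_eq, Set.mem_iUnion, Set.mem_inter_iff, Finset.mem_range,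
      exists_prop, and_assoc]
  rw [hset]
  refine (measureReal_biUnion_finset_le _ _).trans ?_
  have hle : ∀ a, P.real (startEvent X μ δ N R a ∩ {ω | ¬ GoodFrom μ δ N (fun j => X j ω) a})
      ≤ q * P.real (startEvent X μ δ N R a) := by
    intro a
    rw [startEvent_inter_bad hX hind]
    -- A single outcome starting a static round at `a` certifies the deterministic condition `N - a
    -- > βkL` that `hbad` requires.
    rcases Set.eq_empty_or_nonempty (startEvent X μ δ N R a) with he | ⟨ω, hω⟩
    · simp [he]
    · rw [mul_comm]
      refine mul_le_mul_of_nonneg_right (hbad a ?_) measureReal_nonneg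
      have hp := hω.1.1
      rcases run_invariant hk hN hL hμ hsum (fun j => X j ω) a with ⟨h, _⟩ | ⟨_, b, h⟩
      · simp [hp] at h
      · have h1 := h.roundInv
        have h2 := h.start_add
        have h3 := h.start_add_threshold
        rw [hω.1.2] at h2
        simp only [Finset.sum_const_zero, add_zero] at h2
        rw [hp] at h1
        have : N - a = (run μ δ N (fun j => X j ω) a).threshold := by omega
        rw [this]
        exact h1.1
  refine (Finset.sum_le_sum fun a _ => hle a).trans ?_
  rw [← Finset.mul_sum]
  exact mul_le_mul_of_nonneg_left (sum_startEvent_le hX N) hq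

end Probability

/-! ### Log log estimates and conclusion. -/

lemma one_le_logLog (x : ℝ) : 1 ≤ logLog x := le_max_left _ _

lemma logLog_mono {x y : ℝ} (hx : 0 < x) (hxy : x ≤ y) : logLog x ≤ logLog y := by
  unfold logLog
  gcongr

/-- From `ln(4/3) ≥ 1/4` and `β/4 ≤ 5/2` the bound is `8 + 4 logLog`; `logLog ≥ 1` absorbs the
constant. -/
lemma tailRounds_le {k : ℕ} {δ : ℝ} (hL : 0 < Real.log (k / δ)) :
    tailRounds k δ ≤ 12 * logLog (k / δ) := by
  have hQ := one_le_logLog (k / δ)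
  have hQ' : Real.log (max 1 (Real.log (k / δ))) ≤ logLog (k / δ) := le_max_right _ _
  have hlog : (1 : ℝ) / 4 ≤ Real.log (4 / 3) := by
    have := Real.one_sub_inv_le_log_of_pos (x := 4 / 3) (by norm_num)
    norm_num at this ⊢
    linarith
  unfold tailRounds
  set L := Real.log (k / δ)
  have hb := beta_pos
  have hM : 1 ≤ max 1 L := le_max_left _ _
  have h1 : Real.log (beta * L / 4) ≤ 3 / 2 + logLog (k / δ) := by
    calc Real.log (beta * L / 4) ≤ Real.log (5 / 2 * max 1 L) := by
          refine Real.log_le_log (by positivity) ?_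
          have := beta_le_ten
          have : L ≤ max 1 L := le_max_right _ _
          nlinarith
      _ = Real.log (5 / 2) + Real.log (max 1 L) := Real.log_mul (by norm_num) (by positivity)
      _ ≤ _ := by
          have := Real.log_le_sub_one_of_pos (x := 5 / 2) (by norm_num)
          linarith
  have h2 : max 0 (Real.log (beta * L / 4)) / Real.log (4 / 3)
      ≤ (3 / 2 + logLog (k / δ)) / (1 / 4) := by
    gcongr
    exact max_le (by linarith) h1
  linarith

lemma potential_sub_tailRounds_le {k N : ℕ} {δ : ℝ} (hk : 0 < k) (hN : 0 < N)
    (hL : 0 < Real.log (k / δ)) :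
    potential k δ (nextPhase k δ .staticSlack N) N - tailRounds k δ
      ≤ 5 * logLog (N / (k * Real.log (k / δ))) := by
  have hP := one_le_logLog (N / (k * Real.log (k / δ)))
  rcases nextPhase_staticSlack_cases (δ := δ) hk hN with h1 | ⟨h1, h2⟩
  · linarith
  · have hy := one_lt_logb_ratio hk hL h2
    have hr := two_lt_ratio hk hL h2
    have hP' : Real.log (max 1 (Real.log (N / (k * Real.log (k / δ)))))
        ≤ logLog (N / (k * Real.log (k / δ))) := le_max_right _ _
    have hc := four_lt_slackConst_sq
    have hk' : (0 : ℝ) < k := by exact_mod_cast hk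
    have hle : (N : ℝ) / (slackConst ^ 2 * (k * Real.log (k / δ)))
        ≤ N / (k * Real.log (k / δ)) := by
      have : 0 < k * Real.log (k / δ) := by positivity
      exact div_le_div_of_nonneg_left (by positivity) this (by nlinarith)
    rw [h1]
    simp only [potential]
    set x := (N : ℝ) / (k * Real.log (k / δ))
    set y := (N : ℝ) / (slackConst ^ 2 * (k * Real.log (k / δ)))
    have h2' : (1 : ℝ) / 2 ≤ Real.log 2 := by have := Real.log_two_gt_d9; linarith
    have hM : 1 ≤ max 1 (Real.log x) := le_max_left _ _
    have h3 : Real.logb 2 y ≤ 2 * max 1 (Real.log x) := by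
      have : Real.log y ≤ max 1 (Real.log x) :=
        (Real.log_le_log (by linarith) hle).trans (le_max_right _ _)
      rw [Real.logb, div_le_iff₀ (by linarith)]
      nlinarith
    have h4 : Real.log (Real.logb 2 y) ≤ 1 + logLog x := by
      calc Real.log (Real.logb 2 y) ≤ Real.log (2 * max 1 (Real.log x)) :=
            Real.log_le_log (by linarith) h3
        _ = Real.log 2 + Real.log (max 1 (Real.log x)) :=
            Real.log_mul (by norm_num) (by positivity)
        _ ≤ _ := by
            have := Real.log_two_lt_d9
            linarith
    have h5 : Real.logb 2 (Real.logb 2 y) ≤ 2 * (1 + logLog x) := by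
      rw [Real.logb, div_le_iff₀ (by linarith)]
      nlinarith
    linarith

/-- With a single player, every static-slack round is good. -/
lemma goodFrom_of_single {N a : ℕ} {μ : Fin 1 → ℝ} {δ : ℝ} {x : ℕ → Fin 1}
    (hL : 0 < Real.log ((1 : ℕ) / δ)) (hsum : ∑ i, μ i = 1)
    (ha : beta * (1 : ℕ) * Real.log ((1 : ℕ) / δ) < (N - a : ℕ)) : GoodFrom μ δ N x a := by
  intro i
  have hμ : μ i = 1 := by
    rw [Subsingleton.elim i 0]
    simpa using hsum
  have ht := target_pos hL ha
  have h1 : (((Finset.Ico a (a + ⌊target 1 δ (N - a)⌋₊)).filter fun j => x j = i).card : ℝ)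
      ≤ target 1 δ (N - a) := by
    refine le_trans ?_ (Nat.floor_le ht.le)
    exact_mod_cast (Finset.card_filter_le _ _).trans (by simp)
  refine h1.trans_lt ?_
  simp only [slack, hμ]
  simp only [sub_self, mul_zero, zero_mul, Real.sqrt_zero]
  linarith

/-- If the first static-slack rounds are good, both measured quantities obey their bounds. -/
lemma cost_le_of_good {k N : ℕ} {μ : Fin k → ℝ} {δ : ℝ} (hk : 0 < k) (hN : 0 < N)
    (hL : 0 < Real.log (k / δ)) (hμ : ∀ i, 0 ≤ μ i) (hsum : ∑ i, μ i = 1) (x : ℕ → Fin k)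
    (hgood : ∀ a < N, StaticStart (run μ δ N x a) →
      (run μ δ N x a).rounds ≤ ⌊5 * logLog (N / (k * Real.log (k / δ)))⌋₊ →
      GoodFrom μ δ N x a) :
    ((run μ δ N x N).rounds : ℝ) ≤
      60 * (logLog (N / (k * Real.log (k / δ))) + logLog (k / δ)) ∧
    ((run μ δ N x N).messages : ℝ) ≤
      60 * (k * logLog (N / (k * Real.log (k / δ))) + k * logLog (k / δ)) := by
  have hP := one_le_logLog (N / (k * Real.log (k / δ)))
  have hQ := one_le_logLog (k / δ)
  have h1 := rounds_add_potential_le hk hN hL hμ hsum x (potential_sub_tailRounds_le hk hN hL)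
    (fun a ha hs hr => hgood a ha hs (Nat.le_floor hr)) N
  have h2 := potential_sub_tailRounds_le hk hN hL
  have h3 := tailRounds_le hL
  have halarm := (run_phase_eq_alarm_iff hk hN hL hμ hsum x N).mpr le_rfl
  have hm : (run μ δ N x N).messages ≤ 5 * k * (run μ δ N x N).rounds := by
    rcases run_invariant hk hN hL hμ hsum x N with ⟨_, _, h⟩ | ⟨h, _⟩
    · exact h
    · exact absurd halarm h
  rw [halarm, show ∀ m, potential k δ .alarm m = 1 from fun _ => rfl] at h1
  have hr : ((run μ δ N x N).rounds : ℝ)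
      ≤ 12 * (logLog (N / (k * Real.log (k / δ))) + logLog (k / δ)) := by linarith
  refine ⟨by linarith, ?_⟩
  have hm' : ((run μ δ N x N).messages : ℝ) ≤ 5 * k * (run μ δ N x N).rounds := by
    exact_mod_cast hm
  have hk' : (0 : ℝ) ≤ 5 * k := by positivity
  have := mul_le_mul_of_nonneg_left hr hk'
  linarith

/-- The probability that one of the relevant static-slack rounds is bad. -/
lemma exists_bad_le_logLog {Ω : Type*} [MeasurableSpace Ω] {P : Measure Ω}
    [IsProbabilityMeasure P] {k N : ℕ} {X : ℕ → Ω → Fin k} {μ : Fin k → ℝ} {δ : ℝ} (hk : 0 < k)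
    (hN : 0 < N) (h0 : 0 < δ) (h1 : δ < 1) (hμ : ∀ i, 0 ≤ μ i) (hsum : ∑ i, μ i = 1)
    (hX : ∀ j, Measurable (X j)) (hind : iIndepFun X P)
    (hlaw : ∀ j i, P.real {ω | X j ω = i} = μ i) :
    P.real {ω | ∃ a < N, StaticStart (run μ δ N (fun j => X j ω) a) ∧
      (run μ δ N (fun j => X j ω) a).rounds ≤ ⌊5 * logLog (N / (k * Real.log (k / δ)))⌋₊ ∧
      ¬ GoodFrom μ δ N (fun j => X j ω) a} ≤ δ * (60 * logLog N) := by
  have hL := log_div_pos hk h0 h1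
  have hP := one_le_logLog (N / (k * Real.log (k / δ)))
  have hNlog := one_le_logLog N
  -- Passing from `N/(kL)` to `N` needs `kL ≥ 1`, which `L ≥ ln 2` gives for `k ≥ 2`. For `k = 1` it
  -- may fail when `δ` is near `1`, but then no round is bad.
  rcases Nat.lt_or_ge 1 k with hk2 | hk1
  · refine (exists_bad_le hk hN hL hμ hsum hX hind h0.le fun a ha =>
      not_goodFrom_le hk h0 h1 hX hind hlaw ha).trans ?_
    gcongr
    refine (Nat.floor_le (by positivity)).trans ?_
    have hN' : (0 : ℝ) < N := by exact_mod_cast hN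
    have hkL : 1 ≤ k * Real.log (k / δ) := by
      have hk' : (2 : ℝ) ≤ k := by exact_mod_cast hk2
      have : Real.log 2 ≤ Real.log (k / δ) := by
        refine Real.log_le_log (by norm_num) ?_
        rw [le_div_iff₀ h0]
        linarith
      have := Real.log_two_gt_d9
      nlinarith
    have : logLog (N / (k * Real.log (k / δ))) ≤ logLog N :=
      logLog_mono (by positivity) (div_le_self hN'.le hkL)
    linarith
  · obtain rfl : k = 1 := by omega
    refine (exists_bad_le hk hN hL hμ hsum hX hind le_rfl fun a ha => ?_).trans ?_
    · simp [goodFrom_of_single hL hsum ha]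
    · rw [zero_mul]; positivity

end DistTracking

theorem mainTheorem1 :
    ∃ C : ℝ, 0 < C ∧
      ∀ (k N : ℕ) (δ : ℝ) (μ : Fin k → ℝ),
        0 < k → 0 < N → 0 < δ → δ < 1 → (∀ i, 0 ≤ μ i) → ∑ i, μ i = 1 →
        -- on every input stream the alarm is raised exactly at the arrival of item number `N`
        (∀ (x : ℕ → Fin k) (n : ℕ),
          (DistTracking.run μ δ N x n).phase = DistTracking.Phase.alarm ↔ N ≤ n) ∧
        -- the number of rounds and of messages of the whole run, for independent items
        ∀ (Ω : Type*) [MeasurableSpace Ω] (P : Measure Ω) [IsProbabilityMeasure P]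
          (X : ℕ → Ω → Fin k),
          (∀ j, Measurable (X j)) → iIndepFun X P →
          (∀ j i, P.real {ω | X j ω = i} = μ i) →
          1 - δ * (C * DistTracking.logLog N) ≤
            P.real {ω |
              ((DistTracking.run μ δ N (fun j => X j ω) N).rounds : ℝ) ≤
                C * (DistTracking.logLog (N / (k * Real.log (k / δ)))
                  + DistTracking.logLog (k / δ)) ∧
              ((DistTracking.run μ δ N (fun j => X j ω) N).messages : ℝ) ≤
                C * (k * DistTracking.logLog (N / (k * Real.log (k / δ)))
                  + k * DistTracking.logLog (k / δ))} := by
  -- `60 = 5 · 12`: `5k` messages per round, and a factor `12` in the bound on rounds.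
  refine ⟨60, by norm_num, fun k N δ μ hk hN h0 h1 hμ hsum => ?_⟩
  have hL := DistTracking.log_div_pos hk h0 h1
  refine ⟨DistTracking.run_phase_eq_alarm_iff hk hN hL hμ hsum, ?_⟩
  intro Ω _ P _ X hX hind hlaw
  have hbad := DistTracking.exists_bad_le_logLog hk hN h0 h1 hμ hsum hX hind hlaw
  refine (sub_le_sub_left hbad 1).trans ?_
  -- Covering the whole space by the two events uses only subadditivity, so the cost event need not
  -- be shown measurable.
  rw [sub_le_iff_le_add, ← probReal_univ (μ := P)]
  refine (measureReal_mono ?_).trans (measureReal_union_le _ _)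
  intro ω _
  by_contra hω
  simp only [Set.mem_union, not_or] at hω
  refine hω.1 (DistTracking.cost_le_of_good hk hN hL hμ hsum (fun j => X j ω) ?_)
  intro a ha hs hr
  by_contra hg
  exact hω.2 ⟨a, ha, hs, hr, hg⟩
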